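/- For a poset $P$, let $\Sigma P$ denote its Scott space: $P$ with the topology whose open sets are the upper sets $U$ such that $\bigvee D\in U$ implies $D\cap U\neq\emptyset$ for every nonempty directed $D\subseteq P$ having a supremum. A space is sober if every nonempty irreducible closed set is the closure of a unique point. Let $\mathcal D(P)$ be the set of all nonempty compact saturated subsets of $\Sigma P$, ordered by reverse inclusion (a set is saturated if it is the intersection of all open sets containing it). A complete Heyting algebra (frame) is a complete lattice in which $a\wedge\bigvee_i a_i=\bigvee_i(a\wedge a_i)$ always holds; it is a spatial frame if every element is a meet of prime elements, where $p$ is prime if $a\wedge b\le p$ implies $a\le p$ or $b\le p$. There exists a complete lattice $M$ whose Scott space $\Sigma M$ is non-sober and for which $\mathcal D(M)$ is a complete Heyting algebra, indeed a spatial frame, whose Scott space $\Sigma\mathcal D(M)$ is non-sober. Moreover, for every complete lattice $M$ with non-sober Scott space (in particular, for the one constructed by Isbell), $\mathcal D(M)$ is a complete Heyting algebra, indeed a spatial frame, and its Scott space is non-sober. Since every complete Heyting algebra is distributive, there is in particular a distributive complete lattice whose Scott space is non-sober, which answers Jung's question. -/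

import Mathlib

/-- A topological space is sober if every (nonempty) irreducible closed set is the closure of a
unique singleton. -/
def IsSober (X : Type*) [TopologicalSpace X] : Prop :=
  ∀ F : Set X, IsIrreducible F → IsClosed F → ∃! x : X, closure {x} = F

/-- A set is saturated if it equals the intersection of all open sets containing it. -/
def IsSaturatedSet {X : Type*} [TopologicalSpace X] (A : Set X) : Prop :=
  A = ⋂₀ {U : Set X | IsOpen U ∧ A ⊆ U}

/-- The set of all nonempty compact saturated subsets of a topological space. -/
@[ext]
structure CompactSaturated (X : Type*) [TopologicalSpace X] where
  carrier : Set X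
  nonempty : carrier.Nonempty
  isCompact : IsCompact carrier
  isSaturated : IsSaturatedSet carrier

/-- The nonempty compact saturated subsets are ordered by reverse inclusion. -/
instance CompactSaturated.instPartialOrder (X : Type*) [TopologicalSpace X] :
    PartialOrder (CompactSaturated X) where
  le K₁ K₂ := K₂.carrier ⊆ K₁.carrier
  le_refl K := subset_refl K.carrier
  le_trans _ _ _ h₁ h₂ := subset_trans h₂ h₁
  le_antisymm _ _ h₁ h₂ := CompactSaturated.ext (subset_antisymm h₂ h₁)

/-- The poset `𝒟(P)` of all nonempty compact saturated subsets of the Scott space of a poset `P`,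
ordered by reverse inclusion. -/
abbrev ScottCompactSaturated (P : Type*) [PartialOrder P] : Type _ :=
  CompactSaturated (Topology.WithScott P)

/-- Prime elements of a meet-semilattice (the top element, if there is one, counts as prime). -/
def IsPrimeElement {S : Type*} [SemilatticeInf S] (p : S) : Prop :=
  ∀ a b : S, a ⊓ b ≤ p → a ≤ p ∨ b ≤ p

/-- A poset is a complete Heyting algebra (a frame) if its own order carries such a structure. -/
def IsCompleteHeytingAlgebra (P : Type*) [inst : PartialOrder P] : Prop :=
  ∃ F : Order.Frame P, F.toPartialOrder = inst

/-- A poset is a spatial frame if its own order makes it a complete Heyting algebra in which every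
element is a meet of prime elements. -/
def IsSpatialFrame (P : Type*) [inst : PartialOrder P] : Prop :=
  ∃ F : Order.Frame P, F.toPartialOrder = inst ∧
    ∀ a : P, ∃ S : Set P, (∀ p ∈ S, IsPrimeElement p) ∧ a = sInf S

/-! In a complete lattice, `x ⊔ y` is Scott continuous in each variable separately. From this follow
coherence (`scott_isCompact_inter`) and well-filteredness (`scott_wellFiltered`), so compact
saturated sets are closed under arbitrary intersections. Hence in 𝒟(M) joins are intersections and
binary meets are unions. The frame law is set distributivity, and K is the meet of the prime
elements ↑x with x ∈ K.

Sobriety descends from 𝒟(M) to M. For A irreducible closed in M, the K meeting A form a set that is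
closed by well-filteredness and irreducible by continuity of x ↦ ↑x. If K is its greatest element
and a ∈ K ∩ A, then K ⊆ ↑b for every b ∈ A, so a is greatest in A.

A non-sober M is built from a countable set of points with convergent sequences, any two of which
share only finitely many points. Its elements are the thin sets under reverse inclusion. The
nonempty ones form an irreducible closed set (`exists_single_mem_inter`, `sSup_nonempty`) with no
greatest element, since all singletons are maximal in it. -/

open Set

/-! ### Coherence and well-filteredness of the Scott topology on a complete lattice. -/

section ScottCompleteLattice

variable {L : Type*} [CompleteLattice L] [TopologicalSpace L] [Topology.IsScott L univ]

theorem scott_isOpen_iff {U : Set L} :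
    IsOpen U ↔ IsUpperSet U ∧
      ∀ D : Set L, D.Nonempty → DirectedOn (· ≤ ·) D → sSup D ∈ U → ∃ d ∈ D, d ∈ U := by
  rw [Topology.IsScott.isOpen_iff_isUpperSet_and_dirSupInaccOn (D := univ)]
  refine and_congr_right fun _ => ⟨fun h D hD hd hs => ?_, fun h D _ hD hd a ha haU => ?_⟩
  · exact h (mem_univ D) hD hd (isLUB_sSup D) hs
  · exact h D hD hd (ha.sSup_eq.symm ▸ haU)

theorem scott_isUpperSet {U : Set L} (h : IsOpen U) : IsUpperSet U :=
  (scott_isOpen_iff.1 h).1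

theorem scott_isOpen_compl_Iic (x : L) : IsOpen (Iic x)ᶜ :=
  (Topology.IsScott.instClosedIicTopologyOfUnivSet).isClosed_Iic x |>.isOpen_compl

theorem isSaturatedSet_iff_isUpperSet {A : Set L} : IsSaturatedSet A ↔ IsUpperSet A := by
  constructor
  · intro h
    rw [h]
    exact isUpperSet_sInter fun U hU => scott_isUpperSet hU.1
  · intro h
    refine subset_antisymm (subset_sInter fun U hU => hU.2) fun x hx => ?_
    by_contra hxA
    exact hx _ ⟨scott_isOpen_compl_Iic x, fun y hy hyx => hxA (h hyx hy)⟩ le_rfl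

/-- Translation by a join is Scott continuous. -/
theorem isOpen_setOf_sup_mem {U : Set L} (hU : IsOpen U) (y : L) : IsOpen {x | x ⊔ y ∈ U} := by
  obtain ⟨hup, hD⟩ := scott_isOpen_iff.1 hU
  refine scott_isOpen_iff.2 ⟨fun a b hab ha => hup (sup_le_sup_right hab y) ha, ?_⟩
  intro D hne hdir hs
  have hs' : sSup ((· ⊔ y) '' D) ∈ U := by
    refine hup ?_ hs
    obtain ⟨d, hd⟩ := hne
    refine sup_le (sSup_le fun e he => le_sup_left.trans (le_sSup (mem_image_of_mem _ he))) ?_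
    exact le_sup_right.trans (le_sSup (mem_image_of_mem _ hd))
  obtain ⟨_, ⟨d, hd, rfl⟩, hdU⟩ := hD _ (hne.image _)
    (directedOn_image.2 (hdir.mono fun _ _ h => sup_le_sup_right h y)) hs'
  exact ⟨d, hd, hdU⟩

/-- A tube lemma: if the join of D lies in the set, the directed open sets {y | y ⊔ d ∈ U}, d ∈ D,
cover K, so a single d suffices. -/
theorem isOpen_setOf_forall_sup_mem {U K : Set L} (hU : IsOpen U) (hK : IsCompact K) :
    IsOpen {x | ∀ y ∈ K, x ⊔ y ∈ U} := by
  refine scott_isOpen_iff.2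
    ⟨fun a b hab ha y hy => scott_isUpperSet hU (sup_le_sup_right hab y) (ha y hy), ?_⟩
  intro D hne hdir hs
  have : Nonempty D := hne.to_subtype
  obtain ⟨d, hd⟩ := hK.elim_directed_cover (fun d : D => {y | y ⊔ d.1 ∈ U})
    (fun d => isOpen_setOf_sup_mem hU _)
    (fun y hy => by
      obtain ⟨d, hd, hdU⟩ :=
        (scott_isOpen_iff.1 (isOpen_setOf_sup_mem hU y)).2 D hne hdir (hs y hy)
      exact mem_iUnion.2 ⟨⟨d, hd⟩, by simpa [sup_comm] using hdU⟩)
    (fun a b => by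
      obtain ⟨c, hc, hac, hbc⟩ := hdir a a.2 b b.2
      exact ⟨⟨c, hc⟩, fun y hy => scott_isUpperSet hU (sup_le_sup_left hac y) hy,
        fun y hy => scott_isUpperSet hU (sup_le_sup_left hbc y) hy⟩)
  exact ⟨d, d.2, fun y hy => by simpa [sup_comm] using hd hy⟩

theorem isCompact_of_directed_cover.{u} {X : Type u} [TopologicalSpace X] {K : Set X}
    (h : ∀ (ι : Type u) (_ : Nonempty ι) (U : ι → Set X), (∀ i, IsOpen (U i)) →
      Directed (· ⊆ ·) U → K ⊆ ⋃ i, U i → ∃ i, K ⊆ U i) : IsCompact K := by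
  refine isCompact_of_finite_subcover fun {ι} U hU hK => ?_
  obtain ⟨t, ht⟩ := h (Finset ι) ⟨∅⟩ (fun t => ⋃ i ∈ t, U i)
    (fun t => isOpen_biUnion fun i _ => hU i)
    (directed_of_isDirected_le fun _ _ h => biUnion_subset_biUnion_left h)
    (iUnion_eq_iUnion_finset U ▸ hK)
  exact ⟨t, ht⟩

/-- The Scott topology of a complete lattice is coherent. -/
theorem scott_isCompact_inter {K₁ K₂ : Set L} (h₁ : IsCompact K₁) (h₂ : IsCompact K₂)
    (u₁ : IsUpperSet K₁) (u₂ : IsUpperSet K₂) : IsCompact (K₁ ∩ K₂) := by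
  refine isCompact_of_directed_cover fun ι _ U hU hdir hK => ?_
  -- Both sets are upper, so they contain every x ⊔ y with x ∈ K₁, y ∈ K₂. Compactness in y, then in
  -- x, puts all these joins into one U i; a point of the intersection is the join x ⊔ x.
  obtain ⟨i, hi⟩ := h₁.elim_directed_cover (fun i => {x | ∀ y ∈ K₂, x ⊔ y ∈ U i})
    (fun i => isOpen_setOf_forall_sup_mem (hU i) h₂)
    (fun x hx => by
      obtain ⟨i, hi⟩ := h₂.elim_directed_cover (fun i => {y | y ⊔ x ∈ U i})
        (fun i => isOpen_setOf_sup_mem (hU i) x)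
        (fun y hy => by
          obtain ⟨i, hi⟩ := mem_iUnion.1 (hK ⟨u₁ le_sup_right hx, u₂ le_sup_left hy⟩ :
            y ⊔ x ∈ ⋃ i, U i)
          exact mem_iUnion.2 ⟨i, hi⟩)
        (fun i j => by
          obtain ⟨k, hik, hjk⟩ := hdir i j
          exact ⟨k, fun y hy => hik hy, fun y hy => hjk hy⟩)
      exact mem_iUnion.2 ⟨i, fun y hy => by simpa [sup_comm] using hi hy⟩)
    (fun i j => by
      obtain ⟨k, hik, hjk⟩ := hdir i j
      exact ⟨k, fun x hx y hy => hik (hx y hy), fun x hx y hy => hjk (hx y hy)⟩)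
  exact ⟨i, fun x hx => by simpa using hi hx.1 x hx.2⟩

theorem scott_isClosed_iff {A : Set L} :
    IsClosed A ↔ IsLowerSet A ∧
      ∀ D : Set L, D.Nonempty → DirectedOn (· ≤ ·) D → D ⊆ A → sSup D ∈ A := by
  rw [← isOpen_compl_iff, scott_isOpen_iff, isUpperSet_compl]
  refine and_congr_right fun _ => forall₃_congr fun D _ _ => ?_
  rw [← not_imp_not]
  simp [subset_def]

/-- For directed D in the lower closure, compactness of K yields one x ∈ K with x ⊔ d ∈ A for all d
∈ D; then x ⊔ sSup D lies in A ∩ K, above sSup D. -/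
theorem isClosed_lowerClosure_inter {A K : Set L} (hA : IsClosed A) (hK : IsCompact K)
    (uK : IsUpperSet K) : IsClosed (lowerClosure (A ∩ K) : Set L) := by
  refine scott_isClosed_iff.2 ⟨(lowerClosure _).lower, fun D hne hdir hD => ?_⟩
  have : Nonempty D := hne.to_subtype
  have key : (K ∩ ⋂ d : D, {x | x ⊔ d.1 ∈ A}).Nonempty := by
    rw [nonempty_iff_ne_empty]
    intro h
    obtain ⟨d, hd⟩ := hK.elim_directed_family_closed (fun d : D => {x | x ⊔ d.1 ∈ A})
      (fun d => by
        rw [← isOpen_compl_iff]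
        exact isOpen_setOf_sup_mem hA.isOpen_compl _) h
      (fun a b => by
        obtain ⟨c, hc, hac, hbc⟩ := hdir a a.2 b b.2
        have hl := (scott_isClosed_iff.1 hA).1
        exact ⟨⟨c, hc⟩, fun y hy => hl (sup_le_sup_left hac y) hy,
          fun y hy => hl (sup_le_sup_left hbc y) hy⟩)
    obtain ⟨x, hx, hdx⟩ := mem_lowerClosure.1 (hD d.2)
    exact (hd ▸ ⟨hx.2, by simpa [sup_eq_left.2 hdx] using hx.1⟩ : x ∈ (∅ : Set L))
  obtain ⟨x, hxK, hx⟩ := key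
  rw [mem_iInter] at hx
  refine mem_lowerClosure.2 ⟨x ⊔ sSup D, ⟨?_, uK le_sup_left hxK⟩, le_sup_right⟩
  by_contra hn
  have hn' : sSup D ∈ {z | z ⊔ x ∈ Aᶜ} := by simpa [sup_comm] using hn
  obtain ⟨d, hd, hdA⟩ :=
    (scott_isOpen_iff.1 (isOpen_setOf_sup_mem hA.isOpen_compl x)).2 D hne hdir hn'
  exact hdA (by simpa [sup_comm] using hx ⟨d, hd⟩)

/-- The Scott topology of a complete lattice is well-filtered. -/
theorem scott_wellFiltered {ι : Type*} [Nonempty ι] {K : ι → Set L} (hc : ∀ i, IsCompact (K i))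
    (hu : ∀ i, IsUpperSet (K i)) (hdir : Directed (· ⊇ ·) K) {U : Set L} (hU : IsOpen U)
    (h : ⋂ i, K i ⊆ U) : ∃ i, K i ⊆ U := by
  by_contra! hn
  -- C is a minimal closed set outside U that meets every K i. Minimality forces C to be the lower
  -- closure of each C ∩ K i, so a maximal element of C lies in every K i, hence in U.
  obtain ⟨C, -, hC⟩ := zorn_superset_nonempty
    {C : Set L | IsClosed C ∧ C ⊆ Uᶜ ∧ ∀ i, (K i ∩ C).Nonempty}
    (fun c hcS hchain hne => ⟨⋂₀ c, ⟨isClosed_sInter fun C hC => (hcS hC).1,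
      (sInter_subset_of_mem hne.some_mem).trans (hcS hne.some_mem).2.1, fun i => by
        have : Nonempty c := hne.to_subtype
        rw [nonempty_iff_ne_empty, sInter_eq_iInter]
        intro he
        obtain ⟨C, hC⟩ := (hc i).elim_directed_family_closed (fun C : c => C.1)
          (fun C => (hcS C.2).1) he (fun a b => by
            rcases hchain.total a.2 b.2 with hab | hab
            · exact ⟨a, subset_rfl, hab⟩
            · exact ⟨b, hab, subset_rfl⟩)
        exact ((hcS C.2).2.2 i).ne_empty hC⟩, fun C hC => sInter_subset_of_mem hC⟩)
    Uᶜ ⟨hU.isClosed_compl, subset_rfl, fun i => by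
      obtain ⟨x, hx, hxU⟩ := not_subset.1 (hn i)
      exact ⟨x, hx, hxU⟩⟩
  obtain ⟨hCc, hCU, hCK⟩ := hC.prop
  have hCl := (scott_isClosed_iff.1 hCc).1
  have hmin : ∀ i, C ⊆ lowerClosure (C ∩ K i) := fun i => by
    have hsub : (lowerClosure (C ∩ K i) : Set L) ⊆ C := fun x hx => by
      obtain ⟨y, hy, hxy⟩ := mem_lowerClosure.1 hx
      exact hCl hxy hy.1
    refine hC.le_of_le ⟨isClosed_lowerClosure_inter hCc (hc i) (hu i), hsub.trans hCU,
      fun j => ?_⟩ hsub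
    obtain ⟨k, hki, hkj⟩ := hdir i j
    obtain ⟨x, hxk, hxC⟩ := hCK k
    exact ⟨x, hkj hxk, subset_lowerClosure ⟨hxC, hki hxk⟩⟩
  obtain ⟨c₀, -, hc₀⟩ := hCK (Classical.arbitrary ι)
  obtain ⟨m, -, hm⟩ := zorn_le_nonempty₀ C (fun c hcC hch y hy =>
    ⟨sSup c, (scott_isClosed_iff.1 hCc).2 c ⟨y, hy⟩ hch.directedOn hcC,
      fun z hz => le_sSup hz⟩) c₀ hc₀
  refine hCU hm.prop (h (mem_iInter.2 fun i => ?_))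
  obtain ⟨y, hy, hmy⟩ := mem_lowerClosure.1 (hmin i hm.prop)
  rw [hm.eq_of_le hy.1 hmy]
  exact hy.2

theorem scott_isCompact_iInter {ι : Type*} {K : ι → Set L} (hc : ∀ i, IsCompact (K i))
    (hu : ∀ i, IsUpperSet (K i)) : IsCompact (⋂ i, K i) := by
  have hfin : ∀ t : Finset ι, IsCompact (⋂ i ∈ t, K i) := by
    classical
    intro t
    induction t using Finset.induction_on with
    | empty =>
      -- The empty intersection is all of L, which is compact because an open set containing ⊥ is
      -- everything.
      refine isCompact_of_directed_cover fun κ _ U hU _ hK => ?_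
      obtain ⟨i, hi⟩ := mem_iUnion.1 (hK (by simp : (⊥ : L) ∈ _))
      exact ⟨i, fun x _ => scott_isUpperSet (hU i) bot_le hi⟩
    | insert a t _ ih =>
      rw [Finset.set_biInter_insert]
      exact scott_isCompact_inter (hc a) ih (hu a) (isUpperSet_iInter₂ fun i _ => hu i)
  refine isCompact_of_directed_cover fun κ _ U hU hdir hK => ?_
  rw [iInter_eq_iInter_finset] at hK ⊢
  -- Finite intersections form a filtered family, so one of them already lies in the union of the
  -- cover.
  obtain ⟨t, ht⟩ := scott_wellFiltered hfin (fun t => isUpperSet_iInter₂ fun i _ => hu i)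
    (directed_of_isDirected_le fun _ _ h => biInter_subset_biInter_left h)
    (isOpen_iUnion hU) hK
  obtain ⟨i, hi⟩ := (hfin t).elim_directed_cover U hU ht hdir
  exact ⟨i, (iInter_subset _ t).trans hi⟩

end ScottCompleteLattice

/-! ### The spatial frame of compact saturated sets. -/

section CompactSaturatedFrame

variable {L : Type*} [CompleteLattice L] [TopologicalSpace L] [Topology.IsScott L univ]

namespace CompactSaturated

theorem isUpperSet (K : CompactSaturated L) : IsUpperSet K.carrier :=
  isSaturatedSet_iff_isUpperSet.1 K.isSaturated

theorem top_mem (K : CompactSaturated L) : ⊤ ∈ K.carrier :=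
  K.isUpperSet le_top K.nonempty.some_mem

/-- The intersection of a family of compact saturated sets. -/
def inter (S : Set (CompactSaturated L)) : CompactSaturated L where
  carrier := ⋂ K : S, K.1.carrier
  nonempty := ⟨⊤, mem_iInter.2 fun K => K.1.top_mem⟩
  isCompact := scott_isCompact_iInter (fun K => K.1.isCompact) fun K => K.1.isUpperSet
  isSaturated := isSaturatedSet_iff_isUpperSet.2 (isUpperSet_iInter fun K => K.1.isUpperSet)

theorem mem_inter {S : Set (CompactSaturated L)} {x : L} :
    x ∈ (inter S).carrier ↔ ∀ K ∈ S, x ∈ K.carrier := by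
  simp [inter]

theorem isLUB_inter (S : Set (CompactSaturated L)) : IsLUB S (inter S) :=
  ⟨fun _ hK _ hx => mem_inter.1 hx _ hK, fun _ hT _ hx => mem_inter.2 fun _ hK => hT hK hx⟩

/-- The union of two compact saturated sets. -/
def union (K₁ K₂ : CompactSaturated L) : CompactSaturated L where
  carrier := K₁.carrier ∪ K₂.carrier
  nonempty := K₁.nonempty.inl
  isCompact := K₁.isCompact.union K₂.isCompact
  isSaturated := isSaturatedSet_iff_isUpperSet.2 (K₁.isUpperSet.union K₂.isUpperSet)

/-- The compact saturated set of all elements above a given one. -/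
def principal (x : L) : CompactSaturated L where
  carrier := Ici x
  nonempty := nonempty_Ici
  isCompact := isCompact_of_directed_cover fun _ _ _ hU _ hK => by
    obtain ⟨i, hi⟩ := mem_iUnion.1 (hK self_mem_Ici)
    exact ⟨i, (scott_isUpperSet (hU i)).Ici_subset hi⟩
  isSaturated := isSaturatedSet_iff_isUpperSet.2 (isUpperSet_Ici x)

theorem le_principal {K : CompactSaturated L} {x : L} : K ≤ principal x ↔ x ∈ K.carrier :=
  ⟨fun h => h self_mem_Ici, fun h => K.isUpperSet.Ici_subset h⟩

theorem principal_le {K : CompactSaturated L} {x : L} : principal x ≤ K ↔ K.carrier ⊆ Ici x :=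
  Iff.rfl

instance : SupSet (CompactSaturated L) := ⟨inter⟩

instance : CompleteLattice (CompactSaturated L) where
  __ := completeLatticeOfSup (CompactSaturated L) isLUB_inter
  inf := union
  inf_le_left _ _ := subset_union_left
  inf_le_right _ _ := subset_union_right
  le_inf _ _ _ h₁ h₂ := union_subset h₁ h₂

theorem mem_inf {K₁ K₂ : CompactSaturated L} {x : L} :
    x ∈ (K₁ ⊓ K₂).carrier ↔ x ∈ K₁.carrier ∨ x ∈ K₂.carrier :=
  Iff.rfl

theorem mem_sSup {S : Set (CompactSaturated L)} {x : L} :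
    x ∈ (sSup S).carrier ↔ ∀ K ∈ S, x ∈ K.carrier :=
  mem_inter

instance : Order.Frame (CompactSaturated L) :=
  Order.Frame.ofMinimalAxioms
    { inf_sSup_le_iSup_inf := fun a s x hx => by
        by_cases hxa : x ∈ a.carrier
        · exact mem_inf.2 (Or.inl hxa)
        · refine mem_inf.2 (Or.inr (mem_sSup.2 fun b hb => ?_))
          exact (mem_inf.1 (le_iSup₂ (f := fun b (_ : b ∈ s) => a ⊓ b) b hb hx)).resolve_left
            hxa }

theorem isPrimeElement_principal (x : L) : IsPrimeElement (principal x) := fun a b h => by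
  simpa only [le_principal, mem_inf] using h

theorem eq_sInf_principal (K : CompactSaturated L) : K = sInf (principal '' K.carrier) := by
  refine le_antisymm (le_sInf ?_) fun x hx => ?_
  · rintro _ ⟨x, hx, rfl⟩
    exact le_principal.2 hx
  · exact le_principal.1 (sInf_le (mem_image_of_mem principal hx))

theorem isSpatialFrame : IsSpatialFrame (CompactSaturated L) :=
  ⟨inferInstance, rfl, fun K => ⟨principal '' K.carrier, by
    rintro _ ⟨x, -, rfl⟩
    exact isPrimeElement_principal x, eq_sInf_principal K⟩⟩

theorem isCompleteHeytingAlgebra : IsCompleteHeytingAlgebra (CompactSaturated L) :=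
  ⟨inferInstance, rfl⟩

end CompactSaturated

end CompactSaturatedFrame

/-! ### Descent of sobriety from 𝒟(M) to M. -/

section Sobriety

open Topology CompactSaturated

variable {L : Type*} [CompleteLattice L] [TopologicalSpace L] [IsScott L univ]

theorem isSober_iff_exists_isGreatest :
    IsSober L ↔ ∀ F : Set L, IsIrreducible F → IsClosed F → ∃ x, IsGreatest F x := by
  refine forall₃_congr fun F _ hc => ⟨?_, ?_⟩
  · rintro ⟨x, rfl, -⟩
    exact ⟨x, by simp [IsScott.closure_singleton, IsGreatest, upperBounds]⟩
  · rintro ⟨x, hx, hmax⟩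
    have : closure {x} = F := by
      rw [IsScott.closure_singleton]
      exact subset_antisymm ((scott_isClosed_iff.1 hc).1.Iic_subset hx) hmax
    refine ⟨x, this, fun y hy => ?_⟩
    rw [← this, IsScott.closure_singleton, IsScott.closure_singleton] at hy
    exact Iic_injective hy

/-- Directed joins are preserved because the intersection of the ↑d, d ∈ D, is ↑(sSup D). -/
theorem continuous_principal [TopologicalSpace (CompactSaturated L)]
    [IsScott (CompactSaturated L) univ] : Continuous (principal : L → CompactSaturated L) := by
  refine continuous_def.2 fun U hU => scott_isOpen_iff.2 ⟨fun x y hxy hx =>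
    scott_isUpperSet hU (principal_le.2 (Ici_subset_Ici.2 hxy)) hx, fun D hne hdir hs => ?_⟩
  have hle : principal (sSup D) ≤ sSup (principal '' D) := fun x hx => mem_Ici.2 <| sSup_le
    fun d hd => mem_sSup.1 hx _ (mem_image_of_mem _ hd)
  obtain ⟨_, ⟨d, hd, rfl⟩, hdU⟩ := (scott_isOpen_iff.1 hU).2 (principal '' D) (hne.image _)
    (directedOn_image.2 (hdir.mono fun _ _ h => principal_le.2 (Ici_subset_Ici.2 h)))
    (scott_isUpperSet hU hle hs)
  exact ⟨d, hd, hdU⟩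

theorem isClosed_setOf_inter_nonempty [TopologicalSpace (CompactSaturated L)]
    [IsScott (CompactSaturated L) univ] {A : Set L} (hA : IsClosed A) :
    IsClosed {K : CompactSaturated L | (K.carrier ∩ A).Nonempty} := by
  refine scott_isClosed_iff.2 ⟨fun K K' h hK => hK.mono (inter_subset_inter_left _ h),
    fun D hne hdir hD => ?_⟩
  by_contra hn
  have : Nonempty D := hne.to_subtype
  obtain ⟨K, hK⟩ := scott_wellFiltered (K := fun K : D => K.1.carrier) (U := Aᶜ)
    (fun K => K.1.isCompact) (fun K => K.1.isUpperSet)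
    (fun a b => by
      obtain ⟨c, hc, hac, hbc⟩ := hdir a a.2 b b.2
      exact ⟨⟨c, hc⟩, hac, hbc⟩) hA.isOpen_compl
    (fun x hx hxA => hn ⟨x, hx, hxA⟩)
  obtain ⟨x, hxK, hxA⟩ := hD K.2
  exact hK hxK hxA

/-- Sobriety of the Scott space of `CompactSaturated L` descends to `L`. -/
theorem IsSober.of_compactSaturated [TopologicalSpace (CompactSaturated L)]
    [IsScott (CompactSaturated L) univ] (h : IsSober (CompactSaturated L)) : IsSober L := by
  rw [isSober_iff_exists_isGreatest] at h ⊢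
  intro A hirr hA
  obtain ⟨K, ⟨a, haK, haA⟩, hmax⟩ := h {K | (K.carrier ∩ A).Nonempty}
    ⟨hirr.nonempty.elim fun a ha => ⟨principal a, a, self_mem_Ici, ha⟩, by
      rintro u v hu hv ⟨K₁, ⟨a₁, h₁, hA₁⟩, hu₁⟩ ⟨K₂, ⟨a₂, h₂, hA₂⟩, hv₂⟩
      -- A set K meeting A at a lies below `principal a`, so the open sets may be tested on
      -- principal filters and pulled back to A.
      obtain ⟨a, haA, hau, hav⟩ := hirr.isPreirreducible _ _ (hu.preimage continuous_principal)
        (hv.preimage continuous_principal) ⟨a₁, hA₁, scott_isUpperSet hu (le_principal.2 h₁) hu₁⟩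
        ⟨a₂, hA₂, scott_isUpperSet hv (le_principal.2 h₂) hv₂⟩
      exact ⟨principal a, ⟨a, self_mem_Ici, haA⟩, hau, hav⟩⟩
    (isClosed_setOf_inter_nonempty hA)
  exact ⟨a, haA, fun b hb => hmax (show principal b ∈ _ from ⟨b, self_mem_Ici, hb⟩) haK⟩

end Sobriety

theorem scottCompactSaturated_of_not_isSober (M : Type*) [CompleteLattice M]
    (h : ¬ IsSober (Topology.WithScott M)) :
    IsCompleteHeytingAlgebra (ScottCompactSaturated M) ∧
      IsSpatialFrame (ScottCompactSaturated M) ∧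
      ¬ IsSober (Topology.WithScott (ScottCompactSaturated M)) := by
  let : CompleteLattice (Topology.WithScott M) := ‹CompleteLattice M›
  have : Topology.IsScott (Topology.WithScott M) univ := ⟨rfl⟩
  let : TopologicalSpace (ScottCompactSaturated M) := Topology.scott _ univ
  exact ⟨CompactSaturated.isCompleteHeytingAlgebra, CompactSaturated.isSpatialFrame,
    fun hs => h (@IsSober.of_compactSaturated (Topology.WithScott M) _ _ _ _ ⟨rfl⟩ hs)⟩

/-! ### A complete lattice with non-sober Scott space. -/

/-- The points of the sequential space underlying the counterexample: any two points `p`, `q` come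
with a matrix of further points `node p q i j`. -/
inductive MatrixPoint : Type
  | base : MatrixPoint
  | node (p q : MatrixPoint) (i j : ℕ) : MatrixPoint

namespace MatrixPoint

/-- An injective code, dominating `φ i`, of the restriction of `φ` to `{0, …, i}`. -/
def prefixCode (φ : ℕ → ℕ) : ℕ → ℕ
  | 0 => φ 0
  | i + 1 => Nat.pair (prefixCode φ i) (φ (i + 1))

theorem le_prefixCode (φ : ℕ → ℕ) : ∀ i, φ i ≤ prefixCode φ i
  | 0 => le_rfl
  | _ + 1 => Nat.right_le_pair _ _

theorem eq_of_prefixCode_eq {φ ψ : ℕ → ℕ} :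
    ∀ {i : ℕ}, prefixCode φ i = prefixCode ψ i → ∀ j ≤ i, φ j = ψ j
  | 0, h, j, hj => by
    obtain rfl : j = 0 := by omega
    exact h
  | i + 1, h, j, hj => by
    obtain ⟨h₁, h₂⟩ := Nat.pair_eq_pair.1 h
    rcases hj.lt_or_eq with hj | rfl
    · exact eq_of_prefixCode_eq h₁ j (by omega)
    · exact h₂

theorem finite_prefixCode_eq {φ ψ : ℕ → ℕ} (h : φ ≠ ψ) :
    {i | prefixCode φ i = prefixCode ψ i}.Finite := by
  obtain ⟨k, hk⟩ := Function.ne_iff.1 h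
  refine (finite_lt_nat k).subset fun i hi => ?_
  by_contra hik
  exact hk (eq_of_prefixCode_eq hi k (not_lt.1 hik))

/-- The index set of the convergent sequences: the rows of the matrix of `p` and `q` converge to
`p`, and the graphs of the functions `prefixCode φ` converge to `q`. -/
inductive Seq : Type
  | row (p q : MatrixPoint) (i : ℕ) : Seq
  | graph (p q : MatrixPoint) (φ : ℕ → ℕ) : Seq

namespace Seq

/-- The limit of a sequence. -/
def limit : Seq → MatrixPoint
  | row p _ _ => p
  | graph _ q _ => q

/-- The terms of a sequence. -/
def term : Seq → ℕ → MatrixPoint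
  | row p q i, n => node p q i n
  | graph p q φ, n => node p q n (prefixCode φ n)

theorem term_injective : ∀ t : Seq, Function.Injective t.term
  | row _ _ _, _, _, h => by simpa [term] using h
  | graph _ _ _, _, _, h => by
    simp only [term, node.injEq, true_and] at h
    exact h.1

/-- The tail of a sequence, together with its limit. -/
def tail (t : Seq) (n : ℕ) : Set MatrixPoint :=
  insert t.limit (t.term '' Ici n)

/-- Distinct rows are disjoint, and a row meets a graph at most once. Two graphs in the same matrix
agree only finitely often, since the codes differ once the coded prefixes do; this is why
`prefixCode φ` replaces φ. -/
theorem finite_range_inter {s t : Seq} (h : s ≠ t) : (range s.term ∩ range t.term).Finite := by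
  cases s with
  | row p q i =>
    cases t with
    | row p' q' i' =>
      refine (finite_empty).subset ?_
      rintro _ ⟨⟨n, rfl⟩, m, hm⟩
      simp only [term, node.injEq] at hm
      obtain ⟨rfl, rfl, rfl, -⟩ := hm
      exact h rfl
    | graph p' q' φ =>
      refine (finite_singleton ((graph p' q' φ).term i)).subset ?_
      rintro _ ⟨⟨n, rfl⟩, m, hm⟩
      simp only [term, node.injEq] at hm
      obtain ⟨rfl, rfl, rfl, rfl⟩ := hm
      rfl
  | graph p q φ =>
    cases t with
    | row p' q' i' =>
      refine (finite_singleton ((graph p q φ).term i')).subset ?_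
      rintro _ ⟨⟨n, rfl⟩, m, hm⟩
      simp only [term, node.injEq] at hm
      obtain ⟨rfl, rfl, rfl, rfl⟩ := hm
      rfl
    | graph p' q' ψ =>
      by_cases hφ : φ = ψ
      · refine (finite_empty).subset ?_
        rintro _ ⟨⟨n, rfl⟩, m, hm⟩
        simp only [term, node.injEq] at hm
        obtain ⟨rfl, rfl, -, -⟩ := hm
        exact h (hφ ▸ rfl)
      · refine ((finite_prefixCode_eq hφ).image (graph p q φ).term).subset ?_
        rintro _ ⟨⟨n, rfl⟩, m, hm⟩
        simp only [term, node.injEq] at hm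
        obtain ⟨rfl, rfl, rfl, hm⟩ := hm
        exact ⟨m, hm.symm, rfl⟩

theorem finite_tail_inter {s t : Seq} (h : s ≠ t) : (s.tail 0 ∩ t.tail 0).Finite := by
  refine ((finite_range_inter h).union (toFinite {s.limit, t.limit})).subset ?_
  rintro x ⟨rfl | ⟨n, -, rfl⟩, ht⟩
  · simp
  · rcases ht with ht | ⟨m, -, hm⟩
    · simp [ht]
    · exact Or.inl ⟨⟨n, rfl⟩, m, hm⟩

end Seq

/-- The sets of points that are finite, or everything, or consist of the limit and some terms of
one of the sequences. -/
def IsThin (S : Set MatrixPoint) : Prop :=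
  S = univ ∨ S.Finite ∨ ∃ t : Seq, t.limit ∈ S ∧ S ⊆ t.tail 0

/-- If the intersection is infinite, almost disjointness forces all members other than `univ` to
belong to one sequence, and so to share its limit. -/
theorem isThin_sInter {C : Set (Set MatrixPoint)} (hC : ∀ S ∈ C, IsThin S) : IsThin (⋂₀ C) := by
  by_cases hfin : (⋂₀ C).Finite
  · exact Or.inr (Or.inl hfin)
  by_cases huniv : ∀ S ∈ C, S = univ
  · exact Or.inl (sInter_eq_univ.2 huniv)
  have hnf : ∀ S ∈ C, S ≠ univ → ∃ t : Seq, t.limit ∈ S ∧ S ⊆ t.tail 0 := fun S hS hu =>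
    ((hC S hS).resolve_left hu).resolve_left fun h => hfin (h.subset (sInter_subset_of_mem hS))
  push Not at huniv
  obtain ⟨S, hS, hSu⟩ := huniv
  obtain ⟨t, -, ht⟩ := hnf S hS hSu
  refine Or.inr (Or.inr ⟨t, fun T hT => ?_, (sInter_subset_of_mem hS).trans ht⟩)
  by_cases hTu : T = univ
  · exact hTu ▸ mem_univ _
  obtain ⟨s, hs, hsT⟩ := hnf T hT hTu
  by_cases hst : s = t
  · exact hst ▸ hs
  · exact absurd ((Seq.finite_tail_inter hst).subset
      (subset_inter ((sInter_subset_of_mem hT).trans hsT) ((sInter_subset_of_mem hS).trans ht)))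
      hfin

/-- The thin sets, to be ordered by reverse inclusion. -/
structure Thin : Type where
  carrier : Set MatrixPoint
  isThin : IsThin carrier

namespace Thin

theorem carrier_injective : Function.Injective carrier := by
  rintro ⟨S, _⟩ ⟨T, _⟩ rfl
  rfl

instance : PartialOrder Thin where
  le S T := T.carrier ⊆ S.carrier
  le_refl _ := subset_rfl
  le_trans _ _ _ h₁ h₂ := subset_trans h₂ h₁
  le_antisymm _ _ h₁ h₂ := carrier_injective (subset_antisymm h₂ h₁)

instance : SupSet Thin where
  sSup C := ⟨⋂₀ (carrier '' C), isThin_sInter (by rintro _ ⟨S, -, rfl⟩; exact S.isThin)⟩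

theorem mem_sSup' {C : Set Thin} {x : MatrixPoint} :
    x ∈ (sSup C).carrier ↔ ∀ S ∈ C, x ∈ S.carrier := by
  simp [sSup]

instance : CompleteLattice Thin :=
  completeLatticeOfSup Thin fun _ =>
    ⟨fun _ hS _ hx => mem_sSup'.1 hx _ hS, fun _ hT _ hx => mem_sSup'.2 fun _ hS => hT hS hx⟩

theorem mem_sSup {C : Set Thin} {x : MatrixPoint} :
    x ∈ (sSup C).carrier ↔ ∀ S ∈ C, x ∈ S.carrier :=
  mem_sSup'

/-- A singleton as a thin set. -/
def single (x : MatrixPoint) : Thin :=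
  ⟨{x}, Or.inr (Or.inl (finite_singleton x))⟩

theorem le_single {S : Thin} {x : MatrixPoint} : S ≤ single x ↔ x ∈ S.carrier :=
  singleton_subset_iff

/-- A tail of a sequence as a thin set. -/
def ofTail (t : Seq) (n : ℕ) : Thin :=
  ⟨t.tail n, Or.inr (Or.inr ⟨t, mem_insert _ _,
    insert_subset_insert (image_mono fun _ _ => Nat.zero_le _)⟩)⟩

theorem ofTail_monotone (t : Seq) : Monotone (ofTail t) := fun _ _ h =>
  insert_subset_insert (image_mono (Ici_subset_Ici.2 h))

/-- By injectivity of the terms, the tails intersect in the limit alone. This makes the sequence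
converge with respect to Scott open sets. -/
theorem single_limit_le (t : Seq) : single t.limit ≤ sSup (range (ofTail t)) := by
  intro x hx
  rw [mem_sSup] at hx
  by_contra hne
  have hmem : ∀ n, x ∈ t.term '' Ici n := fun n => (hx _ ⟨n, rfl⟩).resolve_left hne
  obtain ⟨m, -, rfl⟩ := hmem 0
  obtain ⟨k, hk, hkm⟩ := hmem (m + 1)
  have := t.term_injective hkm
  simp only [mem_Ici] at hk
  omega

theorem sSup_nonempty {D : Set Thin} (hdir : DirectedOn (· ≤ ·) D)
    (hD : ∀ S ∈ D, S.carrier.Nonempty) : (sSup D).carrier.Nonempty := by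
  -- By directedness, a finite member of least cardinality is contained in every member.
  by_cases hfin : ∃ S ∈ D, S.carrier.Finite
  · have hmin := Function.argminOn_mem (fun S : Thin => S.carrier.ncard)
      {S | S ∈ D ∧ S.carrier.Finite} hfin
    set S := Function.argminOn (fun S : Thin => S.carrier.ncard)
      {S | S ∈ D ∧ S.carrier.Finite} hfin
    obtain ⟨hS, hSf⟩ := hmin
    obtain ⟨x, hx⟩ := hD S hS
    refine ⟨x, mem_sSup.2 fun T hT => ?_⟩
    obtain ⟨R, hR, hSR, hTR⟩ := hdir S hS T hT
    have hle : S.carrier.ncard ≤ R.carrier.ncard :=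
      Function.argminOn_le (fun S : Thin => S.carrier.ncard) {S | S ∈ D ∧ S.carrier.Finite}
        (show R ∈ {S | S ∈ D ∧ S.carrier.Finite} from ⟨hR, hSf.subset hSR⟩)
    have : R.carrier = S.carrier := eq_of_subset_of_ncard_le hSR hle hSf
    exact hTR (this ▸ hx)
  push Not at hfin
  by_cases huniv : ∀ S ∈ D, S.carrier = univ
  · exact ⟨base, mem_sSup.2 fun S hS => huniv S hS ▸ mem_univ _⟩
  push Not at huniv
  obtain ⟨S, hS, hSu⟩ := huniv
  obtain ⟨t, -, ht⟩ := (S.isThin.resolve_left hSu).resolve_left (hfin S hS)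
  -- All members are now infinite. A member inside another sequence would have, with S, a common
  -- refinement in D that is finite by almost disjointness.
  refine ⟨t.limit, mem_sSup.2 fun T hT => ?_⟩
  rcases T.isThin with hTu | hTf | ⟨s, hs, hsT⟩
  · exact hTu ▸ mem_univ _
  · exact absurd hTf (hfin T hT)
  by_cases hst : s = t
  · exact hst ▸ hs
  obtain ⟨R, hR, hSR, hTR⟩ := hdir S hS T hT
  exact absurd ((Seq.finite_tail_inter hst).subset
    (subset_inter (Subset.trans hTR hsT) (Subset.trans hSR ht))) (hfin R hR)

variable [TopologicalSpace Thin] [Topology.IsScott Thin univ]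

theorem exists_forall_term_mem {U : Set Thin} (hU : IsOpen U) (t : Seq)
    (ht : single t.limit ∈ U) : ∃ n, ∀ k ≥ n, single (t.term k) ∈ U := by
  obtain ⟨_, ⟨n, rfl⟩, hn⟩ := (scott_isOpen_iff.1 hU).2 (range (ofTail t)) (range_nonempty _)
    ((ofTail_monotone t).directed_le.directedOn_range)
    (scott_isUpperSet hU (single_limit_le t) ht)
  exact ⟨n, fun k hk => scott_isUpperSet hU
    (le_single.2 (show t.term k ∈ (ofTail t n).carrier from Or.inr ⟨k, hk, rfl⟩)) hn⟩

theorem exists_single_mem_inter {U V : Set Thin} (hU : IsOpen U) (hV : IsOpen V)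
    {p q : MatrixPoint} (hp : single p ∈ U) (hq : single q ∈ V) : ∃ x, single x ∈ U ∩ V := by
  -- Row i lies in U from column φ i on. The graph of `prefixCode φ`, which dominates φ, thus stays
  -- in U while converging to q, so it eventually enters V.
  choose φ hφ using fun i => exists_forall_term_mem hU (Seq.row p q i) hp
  obtain ⟨m, hm⟩ := exists_forall_term_mem hV (Seq.graph p q φ) hq
  exact ⟨node p q m (prefixCode φ m), hφ m _ (le_prefixCode φ m), hm m le_rfl⟩

theorem not_isSober : ¬ IsSober Thin := by
  rw [isSober_iff_exists_isGreatest]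
  intro h
  obtain ⟨S, ⟨x, hx⟩, hmax⟩ := h {S | S.carrier.Nonempty}
    ⟨⟨single base, base, rfl⟩, by
      rintro U V hU hV ⟨S, ⟨p, hp⟩, hS⟩ ⟨T, ⟨q, hq⟩, hT⟩
      obtain ⟨x, hx⟩ := exists_single_mem_inter hU hV
        (scott_isUpperSet hU (le_single.2 hp) hS) (scott_isUpperSet hV (le_single.2 hq) hT)
      exact ⟨single x, ⟨x, rfl⟩, hx⟩⟩
    (scott_isClosed_iff.2 ⟨fun S T h hS => hS.mono h,
      fun D _ hdir hD => sSup_nonempty hdir hD⟩)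
  have hall : ∀ y, x = y := fun y => hmax (show single y ∈ _ from ⟨y, rfl⟩) hx
  exact MatrixPoint.noConfusion ((hall base).symm.trans (hall (node base base 0 0)))

end Thin

end MatrixPoint

theorem exists_completeLattice_not_isSober :
    ∃ (M : Type) (_ : CompleteLattice M), ¬ IsSober (Topology.WithScott M) := by
  refine ⟨MatrixPoint.Thin, inferInstance, ?_⟩
  let : TopologicalSpace MatrixPoint.Thin := Topology.scott _ univ
  have : Topology.IsScott MatrixPoint.Thin univ := ⟨rfl⟩
  exact MatrixPoint.Thin.not_isSober

theorem mainTheorem2 :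
    (∃ (M : Type) (_ : CompleteLattice M),
      ¬ IsSober (Topology.WithScott M) ∧
      IsCompleteHeytingAlgebra (ScottCompactSaturated M) ∧
      IsSpatialFrame (ScottCompactSaturated M) ∧
      ¬ IsSober (Topology.WithScott (ScottCompactSaturated M))) ∧
    (∀ (M : Type*) [CompleteLattice M],
      ¬ IsSober (Topology.WithScott M) →
      IsCompleteHeytingAlgebra (ScottCompactSaturated M) ∧
      IsSpatialFrame (ScottCompactSaturated M) ∧
      ¬ IsSober (Topology.WithScott (ScottCompactSaturated M))) := by
  refine ⟨?_, fun M _ h => scottCompactSaturated_of_not_isSober M h⟩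
  obtain ⟨M, _, hM⟩ := exists_completeLattice_not_isSober
  exact ⟨M, _, hM, scottCompactSaturated_of_not_isSober M hM⟩
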